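/- For $N,T\ge 1$, a sample is an $N\times T$ real matrix $X=(x_{it})$ ($x_{it}$ is the return on asset $i$ in period $t$), a portfolio is a vector $w\in\mathbb{R}^N$, and $w$ is normalized if $\sum_i w_i=1$. A coherent risk measure is a family of functions $\hat\rho_{N,T}(w\,|\,X)\in\mathbb{R}$ such that, for all $N,T\ge1$, all samples $X$ and all portfolios $u,v$: 1. if $\sum_i u_i x_{it}\ge 0$ for all $t$, then $\hat\rho(u|X)\le 0$; 2. $\hat\rho(u+v|X)\le\hat\rho(u|X)+\hat\rho(v|X)$; 3. $\hat\rho(au|X)=a\,\hat\rho(u|X)$ for all $a>0$; 4. $\hat\rho(u|X+a)=\hat\rho(u|X)-a$ for all $a\in\mathbb{R}$ and all normalized $u$, where $X+a$ is obtained by adding $a$ to every entry of $X$. The optimization under $\hat\rho$ is feasible on $X$ if $\hat\rho(\cdot\,|X)$ attains a minimum over the normalized portfolios. For each $N\ge1$ let the vector of the returns of the $N$ assets have a nondegenerate elliptical distribution on $\mathbb{R}^N$, i.e. the law of $m+AZ$ with $m\in\mathbb{R}^N$, $A$ an invertible matrix, and $Z$ a random vector with orthogonally invariant law and $P(Z=0)=0$.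 Let $P_{N,T}$ be the probability that the optimization under $\hat\rho_{N,T}$ is feasible on a sample of $T$ independent observations of these returns. Assume that there is a sharp transition with critical value $r_c\in\mathbb{R}$: as $N,T\to\infty$ with $N/T=r$ fixed ($r$ a positive rational number), $P_{N,T}\to 1$ if $r<r_c$, and $P_{N,T}\to0$ if $r>r_c$. Then $r_c\le 1/2$. Moreover, every positive rational $r$ such that $P_{N,T}\to1$ as $N,T\to\infty$ with $N/T=r$ is strictly smaller than $1/2$; in particular, $r_c<1/2$ if this holds at $r=r_c$ itself. -/

import Mathlib

open Filter Topology MeasureTheory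

namespace CoherentPortfolio

/-- A sample of `T` observations of the returns of `N` assets: `X t i` is the return on asset `i`
over the observation period `t`. -/
abbrev Sample (N T : ℕ) : Type := Fin T → EuclideanSpace ℝ (Fin N)

/-- A portfolio is normalized if its weights sum to one. -/
def IsNormalized {N : ℕ} (w : Fin N → ℝ) : Prop := ∑ i, w i = 1

/-- The return of the portfolio `w` over the observation period `t`. -/
def portfolioReturn {N T : ℕ} (w : Fin N → ℝ) (X : Sample N T) (t : Fin T) : ℝ :=
  ∑ i, w i * X t i

/-- The sample obtained by adding the number `a` to each entry. -/
def shift {N T : ℕ} (X : Sample N T) (a : ℝ) : Sample N T :=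
  fun t => WithLp.toLp 2 (fun i => X t i + a)

/-- The axioms of a coherent risk measure estimator `ρ w X` (the estimated risk of the portfolio
`w` on the sample `X`). Translational invariance is required of normalized portfolios: adding `a`
to every asset return adds `a` to the return of a portfolio exactly if its weights sum to one. -/
structure IsCoherent {N T : ℕ} (ρ : (Fin N → ℝ) → Sample N T → ℝ) : Prop where
  monotone : ∀ (X : Sample N T) (u : Fin N → ℝ), (∀ t, 0 ≤ portfolioReturn u X t) → ρ u X ≤ 0
  subadditive : ∀ (X : Sample N T) (u v : Fin N → ℝ), ρ (u + v) X ≤ ρ u X + ρ v X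
  pos_homogeneous : ∀ (X : Sample N T) (a : ℝ) (u : Fin N → ℝ), 0 < a → ρ (a • u) X = a * ρ u X
  translation_invariant : ∀ (X : Sample N T) (a : ℝ) (u : Fin N → ℝ), IsNormalized u →
    ρ u (shift X a) = ρ u X - a

/-- Minimizing the risk over the normalized portfolios is feasible on the sample `X`: there is an
optimal portfolio. -/
def IsFeasible {N T : ℕ} (ρ : (Fin N → ℝ) → Sample N T → ℝ) (X : Sample N T) : Prop :=
  ∃ w : Fin N → ℝ, IsNormalized w ∧ ∀ v : Fin N → ℝ, IsNormalized v → ρ w X ≤ ρ v X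

/-- A spherical distribution: a probability measure on `ℝ^N` that is invariant under all
orthogonal transformations and has no atom at the origin. -/
structure IsSpherical {N : ℕ} (σ : Measure (EuclideanSpace ℝ (Fin N))) : Prop where
  isProbabilityMeasure : IsProbabilityMeasure σ
  map_isometry : ∀ g : EuclideanSpace ℝ (Fin N) ≃ₗᵢ[ℝ] EuclideanSpace ℝ (Fin N), σ.map g = σ
  zero_null : σ {0} = 0

/-- A (nondegenerate) elliptical distribution on `ℝ^N`: the law of `m + A Z`, where `m` is a vector,
`A` an invertible linear map and `Z` has a spherical distribution. The dispersion matrix is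
`A Aᵀ`, which is positive definite. -/
def IsElliptical {N : ℕ} (ν : Measure (EuclideanSpace ℝ (Fin N))) : Prop :=
  ∃ (m : EuclideanSpace ℝ (Fin N))
    (A : EuclideanSpace ℝ (Fin N) ≃L[ℝ] EuclideanSpace ℝ (Fin N))
    (σ : Measure (EuclideanSpace ℝ (Fin N))),
    IsSpherical σ ∧ ν = σ.map (fun z => m + A z)

/-- The probability that the optimization is feasible on a sample of `T` independent observations
drawn from the distribution `ν` of the returns of the `N` assets. -/
noncomputable def feasibilityProb {N : ℕ} (ν : Measure (EuclideanSpace ℝ (Fin N))) (T : ℕ)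
    (ρ : (Fin N → ℝ) → Sample N T → ℝ) : ENNReal :=
  Measure.pi (fun _ : Fin T => ν) {X | IsFeasible ρ X}

/-- The limit in which the pair `(N, T)` goes to infinity with the ratio `N / T = r` fixed. -/
def fixedRatio (r : ℚ) : Filter (ℕ × ℕ) :=
  atTop ⊓ 𝓟 {q | (q.1 : ℚ) / (q.2 : ℚ) = r}

/-- The probability of feasibility tends to `l` as `N, T → ∞` with `N / T = r` fixed. -/
def FeasibilityTendsto (ν : (N : ℕ) → Measure (EuclideanSpace ℝ (Fin N)))
    (ρ : (N T : ℕ) → (Fin N → ℝ) → Sample N T → ℝ) (r : ℚ) (l : ENNReal) : Prop :=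
  Tendsto (fun q : ℕ × ℕ => feasibilityProb (ν q.1) q.2 (ρ q.1 q.2)) (fixedRatio r) (𝓝 l)

/-- There is a sharp feasibility / infeasibility transition with critical ratio `rc`: in the limit
`N, T → ∞` with `N / T` fixed, almost all samples are feasible if `N / T` is below `rc`, and almost
none if it is above. -/
def HasSharpTransition (ν : (N : ℕ) → Measure (EuclideanSpace ℝ (Fin N)))
    (ρ : (N T : ℕ) → (Fin N → ℝ) → Sample N T → ℝ) (rc : ℝ) : Prop :=
  (∀ r : ℚ, 0 < r → (r : ℝ) < rc → FeasibilityTendsto ν ρ r 1) ∧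
  (∀ r : ℚ, 0 < r → rc < (r : ℝ) → FeasibilityTendsto ν ρ r 0)

end CoherentPortfolio

/-! A zero-investment portfolio with positive return in every period destroys feasibility
(`IsCoherent.not_isFeasible`). Restrict to portfolios orthogonal to the all-ones vector and to `m`:
one exists as soon as the projections of the points `A z t` to that complement, of dimension at
least `N - 2`, lie in an open half-space. Signs may be flipped independently without changing the
law, so the probability of missing every half-space is the mean fraction of bad sign patterns. For
vectors in general position in dimension `d`, the bad patterns shatter only sets of size at most `T
- d`, and Pajor's form of Sauer-Shelah bounds their number. If `T ≤ 2 * N`, these sets have size at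
most `T / 2 + 2`, which leaves out at least 1/64 of all subsets. Hence the feasibility probability
is at most 63/64 and cannot tend to 1 when `N / T ≥ 1/2`. -/

namespace CoherentPortfolio

/-! ### Sign patterns and half-spaces -/

/-- The sign vector that is `1` on `s` and `-1` off `s`. -/
def signVector {ι : Type*} [DecidableEq ι] (s : Finset ι) (i : ι) : ℝ := if i ∈ s then 1 else -1

theorem signVector_eq {ι : Type*} [DecidableEq ι] (s : Finset ι) (i : ι) :
    signVector s i = 1 ∨ signVector s i = -1 := by
  unfold signVector; split_ifs <;> simp

/-- The vectors `y i`, after the signs given by `s`, lie in a common open half-space. -/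
def InHalfSpace {ι V : Type*} [DecidableEq ι] [AddCommGroup V] [Module ℝ V]
    (y : ι → V) (s : Finset ι) : Prop :=
  ∃ f : Module.Dual ℝ V, ∀ i, 0 < signVector s i * f (y i)

/-- Any family of at most `d` of the vectors `y i` is linearly independent. -/
def InGeneralPosition {ι V : Type*} [AddCommGroup V] [Module ℝ V]
    (y : ι → V) (d : ℕ) : Prop :=
  ∀ S : Finset ι, S.card ≤ d → LinearIndepOn ℝ y (S : Set ι)

theorem exists_dual_eq_zero_iff_mem {ι V : Type*} [Fintype ι] [AddCommGroup V] [Module ℝ V]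
    {y : ι → V} {S : Finset ι}
    (h : ∀ i ∉ S, y i ∉ Submodule.span ℝ (y '' S)) :
    ∃ u : Module.Dual ℝ V, ∀ i, u (y i) = 0 ↔ i ∈ S := by
  obtain ⟨f, hf⟩ := Module.exists_dual_forall_apply_ne_zero (K := ℝ)
    (fun i : {i // i ∉ S} => (Submodule.span ℝ (y '' S)).mkQ (y i))
    (fun i => by simpa using h i i.2)
  refine ⟨f.comp (Submodule.mkQ _), fun i => ⟨fun hi => ?_, fun hi => ?_⟩⟩
  · by_contra hS
    exact hf ⟨i, hS⟩ hi
  · have : (Submodule.span ℝ (y '' S)).mkQ (y i) = 0 := by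
      simpa using Submodule.subset_span (Set.mem_image_of_mem y hi)
    simp only [LinearMap.comp_apply, this, map_zero]

theorem exists_dual_eq_signVector {ι V : Type*} [DecidableEq ι] [AddCommGroup V]
    [Module ℝ V] {y : ι → V} {S : Finset ι}
    (h : LinearIndepOn ℝ y (S : Set ι)) (s : Finset ι) :
    ∃ v : Module.Dual ℝ V, ∀ i ∈ S, v (y i) = signVector s i := by
  have h1 : LinearIndepOn ℝ (fun i => signVector s i • y i) (S : Set ι) := by
    have := LinearIndependent.units_smul h
      (fun i => if (i : ι) ∈ s then 1 else -1)
    unfold LinearIndepOn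
    convert this using 1
    ext i
    by_cases hi : (i : ι) ∈ s <;> simp [signVector, hi]
  obtain ⟨v, hv⟩ := Module.exists_dual_forall_apply_eq_one h1
  refine ⟨v, fun i hi => ?_⟩
  have := hv i hi
  rcases signVector_eq s i with h | h <;> simp [h] at this ⊢ <;> linarith

/-- Take `u` vanishing on exactly the vectors outside `R`. Its signs prescribe the trace `t` on `R`;
a small perturbation by `v` gives arbitrary signs off `R` without disturbing those on `R`. So bad
patterns never have trace `t`. -/
theorem exists_inHalfSpace_of_card_lt {ι V : Type*} [Fintype ι] [DecidableEq ι] [AddCommGroup V]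
    [Module ℝ V] {y : ι → V} {d : ℕ} (hy : InGeneralPosition y d)
    {R : Finset ι} (hR : Fintype.card ι < R.card + d) :
    ∃ t ⊆ R, ∀ s, R ∩ s = t → InHalfSpace y s := by
  have hS : Rᶜ.card + 1 ≤ d := by
    have := Finset.card_add_card_compl R
    omega
  obtain ⟨u, hu⟩ := exists_dual_eq_zero_iff_mem (y := y) (S := Rᶜ) (fun i hi => by
    have h := hy (insert i Rᶜ) (by rw [Finset.card_insert_of_notMem hi]; exact hS)
    rw [Finset.coe_insert, linearIndepOn_insert (by simpa using hi)] at h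
    exact h.2)
  refine ⟨R.filter (fun i => 0 < u (y i)), Finset.filter_subset _ _, fun s hs => ?_⟩
  obtain ⟨v, hv⟩ := exists_dual_eq_signVector (hy Rᶜ (by omega)) s
  have hpos : ∀ i ∈ R, 0 < signVector s i * u (y i) := by
    intro i hi
    have hne : u (y i) ≠ 0 := fun h => by simpa [hi] using (hu i).1 h
    have hmem : i ∈ s ↔ 0 < u (y i) := by
      have := Finset.ext_iff.1 hs i
      simpa [hi] using this
    unfold signVector
    split_ifs with h
    · simpa using hmem.1 h
    · have : ¬ 0 < u (y i) := fun h' => h (hmem.2 h')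
      have : u (y i) < 0 := lt_of_le_of_ne (not_lt.1 this) hne
      linarith
  have hev : ∀ i, ∀ᶠ δ : ℝ in 𝓝[>] 0, 0 < signVector s i * (u + δ • v) (y i) := by
    intro i
    by_cases hi : i ∈ R
    · have hc : Tendsto (fun δ : ℝ => signVector s i * (u + δ • v) (y i)) (𝓝[>] 0)
          (𝓝 (signVector s i * (u + (0 : ℝ) • v) (y i))) := by
        refine tendsto_nhdsWithin_of_tendsto_nhds (Continuous.tendsto ?_ 0)
        simp only [LinearMap.add_apply, LinearMap.smul_apply]
        fun_prop
      exact hc.eventually_const_lt (by simpa using hpos i hi)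
    · filter_upwards [self_mem_nhdsWithin] with δ hδ
      have h0 : u (y i) = 0 := (hu i).2 (by simpa using hi)
      have hδ : 0 < δ := hδ
      rw [LinearMap.add_apply, LinearMap.smul_apply, h0, hv i (by simpa using hi)]
      rcases signVector_eq s i with h | h <;> simp [h, hδ]
  obtain ⟨δ, hδ⟩ := (eventually_all.2 hev).exists
  exact ⟨u + δ • v, hδ⟩

open Classical in
theorem card_not_inHalfSpace_le {ι V : Type*} [Fintype ι] [DecidableEq ι] [AddCommGroup V]
    [Module ℝ V] {y : ι → V} {d : ℕ} (hy : InGeneralPosition y d) :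
    (Finset.univ.filter fun s => ¬ InHalfSpace y s).card ≤
      (Finset.univ.filter fun R : Finset ι => R.card + d ≤ Fintype.card ι).card := by
  refine (Finset.card_le_card_shatterer _).trans (Finset.card_le_card fun R hR => ?_)
  rw [Finset.mem_shatterer] at hR
  simp only [Finset.mem_filter, Finset.mem_univ, true_and]
  by_contra! hlt
  obtain ⟨t, ht, h⟩ := exists_inHalfSpace_of_card_lt hy hlt
  obtain ⟨s, hs, hst⟩ := hR ht
  exact (Finset.mem_filter.1 hs).2 (h s hst)

/-! ### Counting subsets -/

theorem two_pow_le_card_half_le {ι : Type*} [Fintype ι] :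
    2 ^ Fintype.card ι ≤
      2 * (Finset.univ.filter fun Q : Finset ι => Fintype.card ι ≤ 2 * Q.card).card := by
  classical
  rw [← Fintype.card_finset, ← Finset.card_univ,
    ← Finset.card_filter_add_card_filter_not (s := Finset.univ)
      (fun Q : Finset ι => Fintype.card ι ≤ 2 * Q.card), two_mul]
  refine Nat.add_le_add_left (Finset.card_le_card_of_injOn compl ?_ compl_injective.injOn) _
  intro Q hQ
  have := Finset.card_add_card_compl Q
  simp at hQ ⊢
  omega

theorem card_small_le {T : ℕ} (hT : 5 ≤ T) :
    64 * (Finset.univ.filter fun R : Finset (Fin T) => 2 * R.card ≤ T + 4).card ≤ 63 * 2 ^ T := by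
  obtain ⟨n, rfl⟩ := Nat.exists_eq_add_of_le' hT
  have hhalf := two_pow_le_card_half_le (ι := Fin n)
  have hinj : (Finset.univ.filter fun Q : Finset (Fin n) => Fintype.card (Fin n) ≤ 2 * Q.card).card
      ≤ (Finset.univ.filter fun R : Finset (Fin (n + 5)) => ¬ 2 * R.card ≤ n + 5 + 4).card := by
    -- Adding five fixed points to a `Q` with at least `n / 2` elements gives size at least `n / 2 +
    -- 5`, just past the threshold. At least half of the `2 ^ n` sets qualify, a share 1/64 of `2 ^
    -- (n + 5)`.
    refine Finset.card_le_card_of_injOn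
      (fun Q => (Q.map (Fin.castAddEmb 5)).disjUnion (Finset.univ.map (Fin.natAddEmb n)) ?_) ?_ ?_
    · rw [Finset.disjoint_left]
      intro a ha hb
      simp only [Finset.mem_map, Finset.mem_univ, true_and] at ha hb
      obtain ⟨i, -, rfl⟩ := ha
      obtain ⟨j, hj⟩ := hb
      have := congrArg Fin.val hj
      simp at this
      omega
    · intro Q hQ
      simp only [Finset.coe_filter, Finset.mem_univ, true_and, Set.mem_ofPred_eq, Fintype.card_fin,
        Finset.card_disjUnion, Finset.card_map, Finset.card_univ] at hQ ⊢
      omega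
    · intro Q _ Q' _ h
      ext i
      have := Finset.ext_iff.1 h (Fin.castAdd 5 i)
      simpa [Fin.ext_iff, fun (j : Fin 5) => (show n + (j : ℕ) ≠ i by omega),
        ← Fin.val_inj, Fin.exists_iff] using this
  have htot := Finset.card_filter_add_card_filter_not (s := Finset.univ)
      (fun R : Finset (Fin (n + 5)) => 2 * R.card ≤ n + 5 + 4)
  rw [Finset.card_univ, Fintype.card_finset, Fintype.card_fin] at htot
  rw [Fintype.card_fin] at hhalf hinj
  rw [pow_add] at *
  omega


/-! ### Spherical laws do not charge proper subspaces -/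

theorem IsSpherical.measure_orthogonal_eq {N : ℕ} {σ : Measure (EuclideanSpace ℝ (Fin N))}
    (hσ : IsSpherical σ) {e g : EuclideanSpace ℝ (Fin N)} (h : ‖e‖ = ‖g‖) :
    σ {z | inner ℝ e z = 0} = σ {z | inner ℝ g z = 0} := by
  obtain ⟨L, hL⟩ : ∃ L : EuclideanSpace ℝ (Fin N) ≃ₗᵢ[ℝ] EuclideanSpace ℝ (Fin N), L e = g :=
    ⟨_, Submodule.reflection_sub h⟩
  have hm : MeasurableSet {z : EuclideanSpace ℝ (Fin N) | inner ℝ g z = 0} :=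
    (isClosed_singleton.preimage (by fun_prop : Continuous fun z => inner ℝ g z)).measurableSet
  conv_rhs => rw [← hσ.map_isometry L, Measure.map_apply L.continuous.measurable hm]
  congr 1
  ext z
  simp only [Set.mem_preimage, Set.mem_ofPred_eq]
  rw [← hL, L.inner_map_map]

/-- Fubini against Lebesgue measure on the normals: each `z ≠ 0` is orthogonal to almost no `g`, so
almost every `g` has a null hyperplane. -/
theorem IsSpherical.exists_measure_orthogonal_eq_zero {N : ℕ} (hN : 1 ≤ N)
    {σ : Measure (EuclideanSpace ℝ (Fin N))} (hσ : IsSpherical σ) :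
    ∃ g : EuclideanSpace ℝ (Fin N), g ≠ 0 ∧ σ {z | inner ℝ g z = 0} = 0 := by
  have := hσ.isProbabilityMeasure
  have : Nonempty (Fin N) := ⟨⟨0, hN⟩⟩
  have hmeas : MeasurableSet {p : EuclideanSpace ℝ (Fin N) × EuclideanSpace ℝ (Fin N) |
      inner ℝ p.1 p.2 = 0} :=
    (isClosed_singleton.preimage (by fun_prop :
      Continuous fun p : EuclideanSpace ℝ (Fin N) × EuclideanSpace ℝ (Fin N) =>
        inner ℝ p.1 p.2)).measurableSet
  have hmeas' : MeasurableSet {p : EuclideanSpace ℝ (Fin N) × EuclideanSpace ℝ (Fin N) |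
      inner ℝ p.2 p.1 = 0} := by
    simpa only [real_inner_comm] using hmeas
  have hvol : ∀ z : EuclideanSpace ℝ (Fin N), z ≠ 0 →
      (volume : Measure (EuclideanSpace ℝ (Fin N))) {g | inner ℝ g z = 0} = 0 := by
    intro z hz
    have := Measure.addHaar_submodule volume ((ℝ ∙ z)ᗮ) (by
      intro h
      have : z ∈ (ℝ ∙ z)ᗮ := h ▸ Submodule.mem_top
      exact hz (by simpa [Submodule.mem_orthogonal_singleton_iff_inner_left] using this))
    convert this using 2
    ext g
    simp [Submodule.mem_orthogonal_singleton_iff_inner_left]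
  have h1 : (σ.prod volume) {p : EuclideanSpace ℝ (Fin N) × EuclideanSpace ℝ (Fin N) |
      inner ℝ p.2 p.1 = 0} = 0 := by
    rw [Measure.measure_prod_null hmeas']
    have hz : ∀ᵐ z ∂σ, z ≠ 0 := by
      rw [ae_iff]; simpa using hσ.zero_null
    filter_upwards [hz] with z hz
    exact hvol z hz
  have h2 : (volume.prod σ) {p : EuclideanSpace ℝ (Fin N) × EuclideanSpace ℝ (Fin N) |
      inner ℝ p.1 p.2 = 0} = 0 := by
    rw [← Measure.prod_swap, Measure.map_apply measurable_swap hmeas]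
    exact h1
  rw [Measure.measure_prod_null hmeas] at h2
  have hg : ∀ᵐ g : EuclideanSpace ℝ (Fin N), g ≠ 0 := by
    rw [ae_iff]; simp
  obtain ⟨g, hg, hg'⟩ := (hg.and h2).exists
  exact ⟨g, hg, hg'⟩

/-- A spherical distribution does not charge any proper subspace. -/
theorem IsSpherical.measure_submodule {N : ℕ} {σ : Measure (EuclideanSpace ℝ (Fin N))}
    (hσ : IsSpherical σ) {W : Submodule ℝ (EuclideanSpace ℝ (Fin N))} (hW : W ≠ ⊤) :
    σ W = 0 := by
  obtain ⟨e, he, he0⟩ := Submodule.exists_mem_ne_zero_of_ne_bot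
    (mt Submodule.orthogonal_eq_bot_iff.1 hW)
  have hN : 1 ≤ N := by
    rcases Nat.eq_zero_or_pos N with rfl | h
    · exact absurd (Subsingleton.elim e 0) he0
    · exact h
  obtain ⟨g, hg0, hg⟩ := hσ.exists_measure_orthogonal_eq_zero hN
  have hnorm : ‖(‖g‖ / ‖e‖) • e‖ = ‖g‖ := by
    rw [norm_smul, norm_div, norm_norm, norm_norm, div_mul_cancel₀ _ (norm_ne_zero_iff.2 he0)]
  refine measure_mono_null (fun z hz => ?_) ((hσ.measure_orthogonal_eq hnorm).trans hg)
  simp [inner_smul_left, Submodule.inner_left_of_mem_orthogonal hz he]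

/-! ### Independent samples are almost surely in general position -/

section GeneralPosition

variable {E V : Type*} [MeasurableSpace E] [NormedAddCommGroup E] [NormedSpace ℝ E] [BorelSpace E]
  [SecondCountableTopology E]
  [NormedAddCommGroup V] [NormedSpace ℝ V]

theorem measurableSet_linearIndependent (k : ℕ) (P : E →L[ℝ] V) :
    MeasurableSet {x : Fin k → E | LinearIndependent ℝ fun i => P (x i)} :=
  (isOpen_setOfPred_linearIndependent (𝕜 := ℝ) (E := V) (ι := Fin k)).preimage
    (by fun_prop : Continuous fun (x : Fin k → E) i => P (x i)) |>.measurableSet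

theorem ae_linearIndependent [FiniteDimensional ℝ V]
    {σ : Measure E} [IsProbabilityMeasure σ]
    (hσ : ∀ W : Submodule ℝ E, W ≠ ⊤ → σ W = 0) (P : E →L[ℝ] V) (hP : Function.Surjective P)
    (k : ℕ) (hk : k ≤ Module.finrank ℝ V) :
    ∀ᵐ x ∂Measure.pi (fun _ : Fin k => σ), LinearIndependent ℝ fun i => P (x i) := by
  induction k with
  | zero => exact Eventually.of_forall fun x => linearIndependent_empty_type
  | succ k ih =>
    have hmp := (measurePreserving_piFinSuccAbove (fun _ : Fin (k + 1) => σ) 0).symm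
    have hmp' := hmp.comp (Measure.measurePreserving_swap (μ := Measure.pi fun _ : Fin k => σ)
      (ν := σ))
    rw [← hmp'.map_eq, ae_map_iff hmp'.measurable.aemeasurable
      (measurableSet_linearIndependent _ P)]
    have hmeas := hmp'.measurable (measurableSet_linearIndependent (k + 1) P)
    -- Given `k` independent images, the new vector must avoid the preimage of their span, a proper
    -- subspace because `k < finrank V`.
    refine (Measure.measure_prod_null (MeasurableSet.compl hmeas)).2 ?_
    filter_upwards [ih (by omega)] with x hx
    have hspan : Submodule.span ℝ (Set.range fun i => P (x i)) ≠ ⊤ := by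
      intro h
      have := finrank_range_le_card (R := ℝ) (fun i => P (x i))
      rw [Set.finrank, h, finrank_top, Fintype.card_fin] at this
      omega
    refine measure_mono_null ?_ (hσ ((Submodule.span ℝ (Set.range fun i => P (x i))).comap
      (P : E →ₗ[ℝ] V)) ?_)
    · intro z hz
      by_contra hz'
      apply hz
      have : LinearIndependent ℝ (Fin.cons (P z) (fun i => P (x i)) : Fin (k + 1) → V) :=
        linearIndependent_finCons.2 ⟨hx, hz'⟩
      rw [Set.mem_preimage, Set.mem_ofPred_eq]
      convert this using 1
      ext i
      refine Fin.cases ?_ (fun j => ?_) i <;> simp [MeasurableEquiv.piFinSuccAbove]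
    · intro h
      refine hspan (eq_top_iff.2 fun v _ => ?_)
      obtain ⟨z, rfl⟩ := hP v
      have : z ∈ (⊤ : Submodule ℝ E) := trivial
      rw [← h] at this
      exact this

theorem measurePreserving_comp_injective {ι κ : Type*} [Fintype ι] [Fintype κ] {E : Type*}
    [MeasurableSpace E] (σ : Measure E)
    [IsProbabilityMeasure σ] {f : κ → ι} (hf : Function.Injective f) :
    MeasurePreserving (fun (x : ι → E) k => x (f k)) (Measure.pi fun _ => σ)
      (Measure.pi fun _ => σ) := by
  have h : ProbabilityTheory.iIndepFun (fun k (x : ι → E) => x (f k)) (Measure.pi fun _ => σ) :=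
    (ProbabilityTheory.iIndepFun_pi (μ := fun _ : ι => σ) (X := fun _ => id)
    (fun _ => aemeasurable_id)).precomp hf
  rw [ProbabilityTheory.iIndepFun_iff_map_fun_eq_pi_map 
    (fun k => (measurable_pi_apply (f k)).aemeasurable)] at h
  refine ⟨by fun_prop, h.trans ?_⟩
  congr
  ext1 k
  exact (measurePreserving_eval (fun _ : ι => σ) (f k)).map_eq

theorem ae_inGeneralPosition [FiniteDimensional ℝ V] {ι : Type*} [Fintype ι]
    {σ : Measure E} [IsProbabilityMeasure σ]
    (hσ : ∀ W : Submodule ℝ E, W ≠ ⊤ → σ W = 0) (P : E →L[ℝ] V) (hP : Function.Surjective P) :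
    ∀ᵐ x ∂Measure.pi (fun _ : ι => σ),
      InGeneralPosition (fun i => P (x i)) (Module.finrank ℝ V) := by
  refine ae_all_iff.2 fun S => ?_
  by_cases hS : S.card ≤ Module.finrank ℝ V
  · have e := S.equivFin
    have hmp := measurePreserving_comp_injective σ
      (f := fun k => (e.symm k : ι)) (Subtype.val_injective.comp e.symm.injective)
    have h := hmp.quasiMeasurePreserving.ae (ae_linearIndependent hσ P hP _ hS)
    filter_upwards [h] with x hx _
    exact (linearIndependent_equiv e.symm (f := fun i : S => P (x i))).1 hx
  · exact Eventually.of_forall fun x h => absurd h hS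

end GeneralPosition

/-! ### Arbitrage implies infeasibility -/

theorem portfolioReturn_shift {N T : ℕ} {u : Fin N → ℝ} (hu : IsNormalized u) (X : Sample N T)
    (a : ℝ) (t : Fin T) : portfolioReturn u (shift X a) t = portfolioReturn u X t + a := by
  have hu : ∑ i, u i = 1 := hu
  simp [portfolioReturn, shift, mul_add, Finset.sum_add_distrib, ← Finset.sum_mul, hu]

/-- A zero-investment portfolio with positive returns makes the risk unbounded from below. -/
theorem IsCoherent.not_isFeasible {N T : ℕ} {ρ : (Fin N → ℝ) → Sample N T → ℝ}
    (hρ : IsCoherent ρ) {X : Sample N T} {w : Fin N → ℝ} (hw : ∑ i, w i = 0)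
    (hpos : ∀ t, 0 < portfolioReturn w X t) : ¬ IsFeasible ρ X := by
  rintro ⟨u, hu, hmin⟩
  have hnorm (c : ℝ) : IsNormalized (u + c • w) := by
    have hu : ∑ i, u i = 1 := hu
    simp [IsNormalized, Finset.sum_add_distrib, ← Finset.mul_sum, hu, hw]
  have hret (c : ℝ) (t : Fin T) : portfolioReturn (u + c • w) X t
      = portfolioReturn u X t + c * portfolioReturn w X t := by
    simp [portfolioReturn, add_mul, Finset.sum_add_distrib, Finset.mul_sum, mul_assoc]
  have hev (t : Fin T) : ∀ᶠ c : ℝ in atTop,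
      1 - ρ u X ≤ portfolioReturn u X t + c * portfolioReturn w X t :=
    (tendsto_atTop_add_const_left _ _
      (tendsto_id.atTop_mul_const (hpos t))).eventually_ge_atTop _
  obtain ⟨c, hc⟩ := (eventually_all.2 hev).exists
  -- The returns of `u + c • w` are at least `1 - ρ u X`; after shifting by minus this amount, the
  -- axioms give risk at most `ρ u X - 1`, contradicting minimality.
  have h1 := hρ.monotone (shift X (-(1 - ρ u X))) (u + c • w) (fun t => by
    rw [portfolioReturn_shift (hnorm c), hret]
    linarith [hc t])
  rw [hρ.translation_invariant _ _ _ (hnorm c)] at h1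
  linarith [hmin _ (hnorm c)]

/-! ### Symmetrization over signs -/

theorem signVector_univ {ι : Type*} [Fintype ι] [DecidableEq ι] (i : ι) :
    signVector Finset.univ i = 1 := by
  simp [signVector]

theorem inHalfSpace_signVector_smul {ι V : Type*} [Fintype ι] [DecidableEq ι] [AddCommGroup V]
    [Module ℝ V] (y : ι → V) (s : Finset ι) :
    InHalfSpace (fun i => signVector s i • y i) Finset.univ ↔ InHalfSpace y s := by
  simp [InHalfSpace, signVector_univ]

theorem measurableSet_inHalfSpace {T : ℕ} {E V : Type*} [MeasurableSpace E]
    [NormedAddCommGroup E] [NormedSpace ℝ E] [BorelSpace E] [SecondCountableTopology E]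
    [NormedAddCommGroup V] [NormedSpace ℝ V] [FiniteDimensional ℝ V] (P : E →L[ℝ] V)
    (s : Finset (Fin T)) :
    MeasurableSet {z : Fin T → E | InHalfSpace (fun t => P (z t)) s} := by
  have : {z : Fin T → E | InHalfSpace (fun t => P (z t)) s} =
      ⋃ f : Module.Dual ℝ V, ⋂ t, {z | 0 < signVector s t * f (P (z t))} := by
    ext z; simp [InHalfSpace]
  rw [this]
  -- The union over functionals is uncountable, but a union of open sets is open.
  refine (isOpen_iUnion fun f => isOpen_iInter_of_finite fun t => ?_).measurableSet
  have hf : Continuous f := f.continuous_of_finiteDimensional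
  exact isOpen_lt continuous_const (by fun_prop)

theorem measurePreserving_signVector_smul {N T : ℕ} {σ : Measure (EuclideanSpace ℝ (Fin N))}
    (hσ : IsSpherical σ) (s : Finset (Fin T)) :
    MeasurePreserving (fun (z : Fin T → EuclideanSpace ℝ (Fin N)) t => signVector s t • z t)
      (Measure.pi fun _ => σ) (Measure.pi fun _ => σ) := by
  have := hσ.isProbabilityMeasure
  refine measurePreserving_pi (fun _ => σ) (fun _ => σ)
    (f := fun t (z : EuclideanSpace ℝ (Fin N)) => signVector s t • z) fun t => ?_
  refine ⟨by fun_prop, ?_⟩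
  rcases signVector_eq s t with h | h
  · simp [h]
  · simpa [h] using hσ.map_isometry (LinearIsometryEquiv.neg ℝ)

open Classical in
theorem sum_measure_le_of_ae_card_le {Ω κ : Type*} [MeasurableSpace Ω] [Fintype κ] {μ : Measure Ω}
    [IsProbabilityMeasure μ] {B : κ → Set Ω} (hB : ∀ s, MeasurableSet (B s)) {C : ℕ}
    (h : ∀ᵐ z ∂μ, (Finset.univ.filter fun s => z ∈ B s).card ≤ C) : ∑ s, μ (B s) ≤ C := by
  calc ∑ s, μ (B s) = ∫⁻ z, ∑ s, (B s).indicator 1 z ∂μ := by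
        rw [lintegral_finsetSum _ fun s _ => measurable_one.indicator (hB s)]
        simp [hB]
    _ ≤ ∫⁻ _, (C : ENNReal) ∂μ := by
        refine lintegral_mono_ae ?_
        filter_upwards [h] with z hz
        simpa [Set.indicator_apply] using hz
    _ = C := by simp

theorem IsSpherical.measure_not_inHalfSpace_le {N T : ℕ} {V : Type*} [NormedAddCommGroup V]
    [NormedSpace ℝ V] [FiniteDimensional ℝ V] {σ : Measure (EuclideanSpace ℝ (Fin N))}
    (hσ : IsSpherical σ) (P : EuclideanSpace ℝ (Fin N) →L[ℝ] V) (hP : Function.Surjective P)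
    (hV : N ≤ Module.finrank ℝ V + 2) (hT : 5 ≤ T) (hTN : T ≤ 2 * N) :
    Measure.pi (fun _ : Fin T => σ) {z | ¬ InHalfSpace (fun t => P (z t)) Finset.univ}
      ≤ 63 / 64 := by
  classical
  have := hσ.isProbabilityMeasure
  set μ := Measure.pi fun _ : Fin T => σ with hμ
  set C := (Finset.univ.filter fun R : Finset (Fin T) => 2 * R.card ≤ T + 4).card with hC
  have hsum : ∑ s : Finset (Fin T), μ {z | ¬ InHalfSpace (fun t => P (z t)) s} ≤ C := by
    refine sum_measure_le_of_ae_card_le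
      (fun s => (measurableSet_inHalfSpace P s).compl) ?_
    filter_upwards [ae_inGeneralPosition (fun W hW => hσ.measure_submodule hW) P hP] with z hz
    refine le_trans ?_ ((card_not_inHalfSpace_le hz).trans (Finset.card_le_card fun R hR => ?_))
    · refine Finset.card_le_card fun s hs => ?_
      simpa using hs
    · simp only [Finset.mem_filter, Finset.mem_univ, true_and, Fintype.card_fin] at hR ⊢
      omega
  -- By sign invariance all `2 ^ T` patterns are bad with equal probability, so each carries the
  -- average.
  have hconst (s : Finset (Fin T)) : μ {z | ¬ InHalfSpace (fun t => P (z t)) s} =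
      μ {z | ¬ InHalfSpace (fun t => P (z t)) Finset.univ} := by
    refine Eq.trans ?_ ((measurePreserving_signVector_smul hσ s).measure_preimage
      (measurableSet_inHalfSpace P Finset.univ).compl.nullMeasurableSet)
    congr 1
    ext z
    simp only [Set.mem_preimage, Set.mem_ofPred_eq, map_smul,
      inHalfSpace_signVector_smul]
  simp only [hconst, Finset.sum_const, Finset.card_univ, Fintype.card_finset, Fintype.card_fin,
    nsmul_eq_mul] at hsum
  have hcard : (64 : ENNReal) * C ≤ 63 * 2 ^ T := by exact_mod_cast card_small_le hT
  rw [ENNReal.le_div_iff_mul_le (by simp) (by simp), mul_comm]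
  have h2 : (2 ^ T : ENNReal) ≠ 0 := by simp
  have h2' : (2 ^ T : ENNReal) ≠ ⊤ := by simp
  refine (ENNReal.mul_le_mul_iff_right h2 h2').1 ?_
  calc (2 ^ T : ENNReal) * (64 * _) = 64 * (2 ^ T * _) := by ring
    _ ≤ 64 * C := by gcongr; exact_mod_cast hsum
    _ ≤ _ := hcard.trans_eq (mul_comm _ _)

/-! ### Reduction of elliptical returns to spherical ones -/

theorem finrank_orthogonal_span_pair {N : ℕ} (a b : EuclideanSpace ℝ (Fin N)) :
    N ≤ Module.finrank ℝ (Submodule.span ℝ {a, b})ᗮ + 2 := by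
  have h1 := Submodule.finrank_add_finrank_orthogonal (Submodule.span ℝ {a, b})
  have h2 : Module.finrank ℝ (Submodule.span ℝ {a, b}) ≤ 2 := by
    classical
    have := finrank_span_finset_le_card (R := ℝ) ({a, b} : Finset (EuclideanSpace ℝ (Fin N)))
    rw [Finset.coe_pair, Set.finrank] at this
    exact this.trans Finset.card_le_two
  rw [finrank_euclideanSpace_fin] at h1
  omega

theorem portfolioReturn_eq_inner {N T : ℕ} (w : EuclideanSpace ℝ (Fin N)) (X : Sample N T)
    (t : Fin T) : portfolioReturn w X t = inner ℝ w (X t) := by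
  simp [portfolioReturn, PiLp.inner_apply, mul_comm]

theorem feasibilityProb_le {N T : ℕ} {ν : Measure (EuclideanSpace ℝ (Fin N))}
    (hν : IsElliptical ν) {ρ : (Fin N → ℝ) → Sample N T → ℝ} (hρ : IsCoherent ρ)
    (hT : 5 ≤ T) (hTN : T ≤ 2 * N) : feasibilityProb ν T ρ ≤ 63 / 64 := by
  obtain ⟨m, A, σ, hσ, rfl⟩ := hν
  have := hσ.isProbabilityMeasure
  -- Using a measurable equivalence allows the pushforward to be evaluated on the feasible set,
  -- which is not known to be measurable.
  let e : EuclideanSpace ℝ (Fin N) ≃ᵐ EuclideanSpace ℝ (Fin N) :=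
    (A.toHomeomorph.trans (Homeomorph.addLeft m)).toMeasurableEquiv
  have : IsProbabilityMeasure (σ.map e) := Measure.isProbabilityMeasure_map e.measurable.aemeasurable
  have hpi := Measure.pi_map_pi (μ := fun _ : Fin T => σ) (f := fun _ => e)
    (fun _ => e.measurable.aemeasurable)
  -- Orthogonality to the all-ones vector means zero investment; orthogonality to `m` removes the
  -- drift from the returns.
  set U : Submodule ℝ (EuclideanSpace ℝ (Fin N)) :=
    Submodule.span ℝ {WithLp.toLp 2 (fun _ => (1 : ℝ)), m} with hU
  let P : EuclideanSpace ℝ (Fin N) →L[ℝ] Uᗮ :=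
    Uᗮ.orthogonalProjectionOnto ∘L (A : EuclideanSpace ℝ (Fin N) →L[ℝ] EuclideanSpace ℝ (Fin N))
  have hP : Function.Surjective P := fun v =>
    ⟨A.symm v, by simp [P]⟩
  have hle := hσ.measure_not_inHalfSpace_le P hP (finrank_orthogonal_span_pair _ _) hT hTN
  refine le_trans ?_ hle
  change Measure.pi (fun _ : Fin T => σ.map e) {X | IsFeasible ρ X} ≤ _
  rw [← hpi]
  change (Measure.pi fun _ => σ).map (MeasurableEquiv.piCongrRight fun _ : Fin T => e) _ ≤ _
  rw [MeasurableEquiv.map_apply]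
  refine measure_mono fun z hz => ?_
  rintro ⟨f, hf⟩
  obtain ⟨w, hw⟩ : ∃ w : Uᗮ, ∀ v, f v = inner ℝ w v :=
    ⟨(InnerProductSpace.toDual ℝ Uᗮ).symm (LinearMap.toContinuousLinearMap f), fun v => by simp⟩
  have horth : ∀ x ∈ U, inner ℝ (w : EuclideanSpace ℝ (Fin N)) x = 0 := fun x hx =>
    Submodule.inner_left_of_mem_orthogonal hx w.2
  refine hρ.not_isFeasible (w := (w : EuclideanSpace ℝ (Fin N))) ?_ (fun t => ?_) hz
  · have := horth _ (Submodule.subset_span (Set.mem_insert _ _))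
    simpa [PiLp.inner_apply] using this
  · have h1 := horth m (Submodule.subset_span (by simp))
    have h2 := hf t
    rw [signVector_univ, one_mul, hw] at h2
    rw [portfolioReturn_eq_inner]
    change 0 < inner ℝ (w : EuclideanSpace ℝ (Fin N)) (m + A (z t))
    rw [inner_add_right, h1, zero_add]
    simpa [P] using h2

/-! ### Passage to the limit -/

theorem tendsto_fixedRatio {r : ℚ} (hr : 0 < r) :
    Tendsto (fun k : ℕ => (k * r.num.toNat, k * r.den)) atTop (fixedRatio r) := by
  have hnum : 0 < r.num := Rat.num_pos.2 hr
  refine tendsto_inf.2 ⟨?_, tendsto_principal.2 ?_⟩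
  · rw [← prod_atTop_atTop_eq]
    exact (tendsto_id.atTop_mul_const' (by omega)).prodMk
      (tendsto_id.atTop_mul_const' r.den_pos)
  · filter_upwards [eventually_gt_atTop 0] with k hk
    have h : ((r.num.toNat : ℕ) : ℚ) = (r.num : ℚ) := by
      exact_mod_cast Int.toNat_of_nonneg hnum.le
    have hk' : (k : ℚ) ≠ 0 := by positivity
    simp only [Nat.cast_mul, h]
    rw [mul_div_mul_left _ _ hk', Rat.num_div_den]

/-- Along the multiples of the reduced fraction of `r`, `T ≤ 2 * N` always holds, so the uniform
bound 63/64 persists in the limit. -/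
theorem not_feasibilityTendsto_one {ν : (N : ℕ) → Measure (EuclideanSpace ℝ (Fin N))}
    (hν : ∀ N : ℕ, 1 ≤ N → IsElliptical (ν N))
    {ρ : (N T : ℕ) → (Fin N → ℝ) → Sample N T → ℝ}
    (hρ : ∀ N T : ℕ, 1 ≤ N → 1 ≤ T → IsCoherent (ρ N T))
    {r : ℚ} (hr : 1 / 2 ≤ r) : ¬ FeasibilityTendsto ν ρ r 1 := by
  intro h
  have hr0 : 0 < r := lt_of_lt_of_le (by norm_num) hr
  have hden : r.den ≤ 2 * r.num.toNat := by
    have h1 : (r.den : ℚ) ≤ 2 * r.num := by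
      have h2 := Rat.mul_den_eq_num r
      have h3 : (0 : ℚ) < r.den := by exact_mod_cast r.den_pos
      nlinarith
    have h1 : (r.den : ℤ) ≤ 2 * r.num := by exact_mod_cast h1
    omega
  have hpos := r.den_pos
  have hle : (1 : ENNReal) ≤ 63 / 64 := by
    refine le_of_tendsto (h.comp (tendsto_fixedRatio hr0)) ?_
    filter_upwards [eventually_ge_atTop 5] with k hk
    have hT : 5 ≤ k * r.den := hk.trans (Nat.le_mul_of_pos_right k hpos)
    have hTN : k * r.den ≤ 2 * (k * r.num.toNat) := by nlinarith
    have hN : 1 ≤ k * r.num.toNat := by omega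
    exact feasibilityProb_le (hν _ hN) (hρ _ _ hN (le_trans (by norm_num) hT)) hT hTN
  rw [ENNReal.le_div_iff_mul_le (by simp) (by simp)] at hle
  norm_num at hle

end CoherentPortfolio

theorem corollary3
    (ν : (N : ℕ) → MeasureTheory.Measure (EuclideanSpace ℝ (Fin N)))
    (hν : ∀ N : ℕ, 1 ≤ N → CoherentPortfolio.IsElliptical (ν N))
    (ρ : (N T : ℕ) → (Fin N → ℝ) → CoherentPortfolio.Sample N T → ℝ)
    (hρ : ∀ N T : ℕ, 1 ≤ N → 1 ≤ T → CoherentPortfolio.IsCoherent (ρ N T))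
    (rc : ℝ) (hrc : CoherentPortfolio.HasSharpTransition ν ρ rc) :
    rc ≤ 1 / 2 ∧
      ∀ r : ℚ, 0 < r → CoherentPortfolio.FeasibilityTendsto ν ρ r 1 → r < 1 / 2 := by
  have key : ∀ r : ℚ, CoherentPortfolio.FeasibilityTendsto ν ρ r 1 → r < 1 / 2 := fun r h => by
    by_contra! hr
    exact CoherentPortfolio.not_feasibilityTendsto_one hν hρ hr h
  refine ⟨?_, fun r _ => key r⟩
  by_contra! h
  obtain ⟨r, hr, hr'⟩ := exists_rat_btwn h
  have hr : (1 / 2 : ℚ) < r := by exact_mod_cast (by push_cast; exact hr : ((1 / 2 : ℚ) : ℝ) < r)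
  exact (key r (hrc.1 r (lt_trans (by norm_num) hr) hr')).not_gt hr
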